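/- **Proposition 1B.** Let $p\ge 1$, let $L:\mathbb{R}^p\to\mathbb{R}$ be continuously differentiable with gradient $g=\nabla L$, and suppose that $L$ has a unique minimizer $\theta^*$, i.e. $L(\theta^*)<L(\theta)$ for all $\theta\neq\theta^*$. On a probability space let $\hat\theta_0$ be a random vector in $\mathbb{R}^p$, let $(\pi_k)_{k\ge0}$ be random vectors in $\mathbb{R}^p$ (the perturbations) and $(\epsilon_k^{(+)})_{k\ge0}$, $(\epsilon_k^{(-)})_{k\ge0}$ real random variables (the measurement noises), and let the RDSA iterates be defined by $$\hat\theta_{k+1}=\hat\theta_k-a_k\,\frac{y_k^{(+)}-y_k^{(-)}}{2c_k}\,\pi_k,\qquad y_k^{(\pm)}=L(\hat\theta_k\pm c_k\pi_k)+\epsilon_k^{(\pm)},\qquad k=0,1,2,\dots$$ Suppose that there is a $K<\infty$ such that for every $k\ge K$: $\pi_k$ is uniformly distributed on the sphere of radius $\sqrt p$ centred at the origin of $\mathbb{R}^p$ and is independent of $(\hat\theta_0,\dots,\hat\theta_k)$; each of $\epsilon_k^{(+)}$ and $\epsilon_k^{(-)}$ is independent of $(\hat\theta_0,\dots,\hat\theta_k,\pi_k)$;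 and $E[\epsilon_k^{(+)}-\epsilon_k^{(-)}]=0$. Assume moreover: * **A1.** $a_k,c_k>0$ for all $k$, $a_k\to0$ and $c_k\to0$ as $k\to\infty$, $\sum_{k\ge0}a_k=\infty$ and $\sum_{k\ge0}(a_k/c_k)^2<\infty$. * **A2.** $\sup_k\|\hat\theta_k\|<\infty$ almost surely. * **A3.** $\theta^*$ is an asymptotically stable solution of $dx/dt=-g(x)$: for every $r>0$ there is $\delta>0$ such that every solution on an interval $[0,T]$ with $\|x(0)-\theta^*\|<\delta$ satisfies $\|x(t)-\theta^*\|<r$ on $[0,T]$; and there is $\delta>0$ such that every solution on $[0,\infty)$ with $\|x(0)-\theta^*\|<\delta$ satisfies $x(t)\to\theta^*$ as $t\to\infty$. * **A4.** Let $D(\theta^*)$ be the set of those $x_0\in\mathbb{R}^p$ from which $dx/dt=-g(x)$, $x(0)=x_0$, has a solution on $[0,\infty)$ and every such solution satisfies $x(t)\to\theta^*$ as $t\to\infty$. There is a compact set $S\subseteq D(\theta^*)$ such that, almost surely, $\hat\theta_k\in S$ for infinitely many $k$. * **A5.** There are $\alpha_0,\alpha_1>0$ such that for all $k\ge K$ and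 both choices of sign: $E|\epsilon_k^{(\pm)}|^2\le\alpha_0$, $E[\pi_k\pi_k^T]=I$, and $E\big[\pi_{kl}^2\,L(\hat\theta_k\pm c_k\pi_k)^2\big]\le\alpha_1$ for $l=1,\dots,p$. Then $\hat\theta_k\to\theta^*$ almost surely as $k\to\infty$. -/

import Mathlib

open MeasureTheory ProbabilityTheory Filter Topology

/-- The random-direction gradient estimate
`((y⁺ - y⁻) / (2 c)) π`, with `y⁺ = L (θ + c π) + e₁` and `y⁻ = L (θ - c π) + e₂`. -/
noncomputable def rdsaGradEst {p : ℕ} (L : EuclideanSpace ℝ (Fin p) → ℝ) (c : ℝ)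
    (θ π : EuclideanSpace ℝ (Fin p)) (e₁ e₂ : ℝ) : EuclideanSpace ℝ (Fin p) :=
  (((L (θ + c • π) + e₁) - (L (θ - c • π) + e₂)) / (2 * c)) • π

/-- The RDSA iterates `θ̂ (k+1) = θ̂ k - a k * ĝ k (θ̂ k)`, started at the random vector `θ₀`, with
perturbation vectors `π k` and measurement noises `εp k` (for `y⁺`) and `εm k` (for `y⁻`). -/
noncomputable def rdsa {Ω : Type*} {p : ℕ} (L : EuclideanSpace ℝ (Fin p) → ℝ) (a c : ℕ → ℝ)
    (π : ℕ → Ω → EuclideanSpace ℝ (Fin p)) (εp εm : ℕ → Ω → ℝ)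
    (θ₀ : Ω → EuclideanSpace ℝ (Fin p)) : ℕ → Ω → EuclideanSpace ℝ (Fin p)
  | 0 => θ₀
  | k + 1 => fun ω =>
      rdsa L a c π εp εm θ₀ k ω
        - a k • rdsaGradEst L (c k) (rdsa L a c π εp εm θ₀ k ω) (π k ω) (εp k ω) (εm k ω)

/-- The uniform probability distribution on the sphere of radius `√p` centred at the origin of
`ℝᵖ`: the normalised surface measure of the unit sphere, scaled by `√p`. -/
noncomputable def sphereUniform (p : ℕ) : Measure (EuclideanSpace ℝ (Fin p)) :=
  Measure.map
    (fun x : Metric.sphere (0 : EuclideanSpace ℝ (Fin p)) 1 =>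
      √(p : ℝ) • (x : EuclideanSpace ℝ (Fin p)))
    (((volume : Measure (EuclideanSpace ℝ (Fin p))).toSphere Set.univ)⁻¹ •
      (volume : Measure (EuclideanSpace ℝ (Fin p))).toSphere)

/-- On the time set `I`, `x` solves the gradient flow equation `dx/dt = -g(x)`, `g = ∇L`. -/
def IsGradFlowOn {p : ℕ} (L : EuclideanSpace ℝ (Fin p) → ℝ)
    (x : ℝ → EuclideanSpace ℝ (Fin p)) (I : Set ℝ) : Prop :=
  IsIntegralCurveOn x (fun _ z => -gradient L z) I

/-- `z` is an asymptotically stable solution of `dx/dt = -∇L(x)`: it is stable in the sense of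
Lyapunov (solutions on every interval `[0, T]` that start near `z` stay near `z`) and it
attracts all solutions on `[0, ∞)` that start near it. -/
def IsAsymptoticallyStable {p : ℕ} (L : EuclideanSpace ℝ (Fin p) → ℝ)
    (z : EuclideanSpace ℝ (Fin p)) : Prop :=
  (∀ r > 0, ∃ δ > 0, ∀ T : ℝ, ∀ x : ℝ → EuclideanSpace ℝ (Fin p),
      IsGradFlowOn L x (Set.Icc 0 T) → dist (x 0) z < δ → ∀ t ∈ Set.Icc 0 T, dist (x t) z < r) ∧
  (∃ δ > 0, ∀ x : ℝ → EuclideanSpace ℝ (Fin p),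
      IsGradFlowOn L x (Set.Ici 0) → dist (x 0) z < δ → Tendsto x atTop (𝓝 z))

/-- The domain of attraction `D(z)`: the initial points `x₀` from which `dx/dt = -∇L(x)` has a
solution on `[0, ∞)`, and every such solution (the solution, when it is unique) tends to `z`. -/
def domainOfAttraction {p : ℕ} (L : EuclideanSpace ℝ (Fin p) → ℝ)
    (z : EuclideanSpace ℝ (Fin p)) : Set (EuclideanSpace ℝ (Fin p)) :=
  {x₀ | (∃ x : ℝ → EuclideanSpace ℝ (Fin p), IsGradFlowOn L x (Set.Ici 0) ∧ x 0 = x₀) ∧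
    ∀ x : ℝ → EuclideanSpace ℝ (Fin p),
      IsGradFlowOn L x (Set.Ici 0) → x 0 = x₀ → Tendsto x atTop (𝓝 z)}

/-- Moment conditions on noise, perturbations and loss values at the perturbed iterates
`θ k ± c k • π k`, for all `k ≥ K`, with bounds `α₀`, `α₁` that do not depend on `k`. -/
def MomentConditions {Ω : Type*} [MeasurableSpace Ω] (μ : Measure Ω) {p : ℕ}
    (L : EuclideanSpace ℝ (Fin p) → ℝ) (c : ℕ → ℝ)
    (θ π : ℕ → Ω → EuclideanSpace ℝ (Fin p)) (εp εm : ℕ → Ω → ℝ) (K : ℕ) : Prop :=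
  ∃ α₀ > 0, ∃ α₁ > 0, ∀ k ≥ K,
    (Integrable (fun ω => |εp k ω| ^ 2) μ ∧ ∫ ω, |εp k ω| ^ 2 ∂μ ≤ α₀) ∧
    (Integrable (fun ω => |εm k ω| ^ 2) μ ∧ ∫ ω, |εm k ω| ^ 2 ∂μ ≤ α₀) ∧
    (∀ i j : Fin p, Integrable (fun ω => π k ω i * π k ω j) μ ∧
      ∫ ω, π k ω i * π k ω j ∂μ = (1 : Matrix (Fin p) (Fin p) ℝ) i j) ∧
    (∀ l : Fin p, Integrable (fun ω => (π k ω l) ^ 2 * L (θ k ω + c k • π k ω) ^ 2) μ ∧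
      ∫ ω, (π k ω l) ^ 2 * L (θ k ω + c k • π k ω) ^ 2 ∂μ ≤ α₁) ∧
    (∀ l : Fin p, Integrable (fun ω => (π k ω l) ^ 2 * L (θ k ω - c k • π k ω) ^ 2) μ ∧
      ∫ ω, (π k ω l) ^ 2 * L (θ k ω - c k • π k ω) ^ 2 ∂μ ≤ α₁)

/-!
The proof is the ODE method, shortened by the fact that the mean dynamics is a gradient flow.

*Noise and bias.* Let `k ≥ K` and condition on the iterates up to time `k`. The perturbation can be
integrated out, and the two noise terms cancel in the mean, so the gradient estimate has the
conditional mean `meanGradEst L (c k) (θ k)` (`condExp_rdsaGradEst`). As the uniform law on the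
sphere of radius `√p` has covariance `I`, this mean differs from `∇L (θ k)` by an error that tends
to zero along bounded sequences (`tendsto_meanGradEst_sub_gradient`). The second moment of the
estimate is `O(1 / c k ^ 2)`, so the centred estimates weighted by `a k` sum to an `L²`-bounded
martingale, which converges almost surely (`ae_exists_tendsto_sum_sub_condExp`). Subtracting the
tails of this martingale from the iterates leaves, path by path, a bounded sequence of gradient
steps with vanishing errors (`tendsto_of_perturbed_gradient_steps`).

*From recurrence to a visit near the minimizer.* Restart that sequence, at the time scale of the
gains, at ever later visits close to a point `s` of the compact set `S`. An ultrafilter limit of the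
restarted paths solves `dX/dt = -∇L(X)`, starts at `s` and consists of cluster points of the
sequence (`exists_integralCurve_mapClusterPt`). As `s` lies in the domain of attraction, every such
solution tends to `θstar`, which is therefore a cluster point itself. Solutions of the flow need not
be unique here, and uniqueness is not used.

*From a cluster point to the limit.* Near `θstar` there is no other equilibrium, because its
constant solution would have to be attracted. Hence, close to `θstar` but away from it, each late
step lowers `L`, and since `θstar` is a strict minimizer, the small sublevel sets of `L` around it
trap the sequence (`tendsto_of_mapClusterPt_of_isolated`).
-/

/-! ### The limiting gradient flow -/

section DescentLimit

variable {E : Type*} [NormedAddCommGroup E] [NormedSpace ℝ E]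

/-- The first index at which the partial sums `τ` of the gains reach the time `T`. -/
noncomputable def firstIndex (τ : ℕ → ℝ) (T : ℝ) : ℕ := sInf {n | T ≤ τ n}

variable {τ : ℕ → ℝ}

lemma le_apply_firstIndex (hτ : Tendsto τ atTop atTop) (T : ℝ) : T ≤ τ (firstIndex τ T) :=
  Nat.sInf_mem (s := {n | T ≤ τ n}) ((hτ.eventually_ge_atTop T).exists)

lemma firstIndex_mono (hτ : Tendsto τ atTop atTop) : Monotone (firstIndex τ) := fun _ T hST =>
  Nat.sInf_le (hST.trans (le_apply_firstIndex hτ T))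

lemma firstIndex_apply (hτ : StrictMono τ) (n : ℕ) : firstIndex τ (τ n) = n := by
  have : {m | τ n ≤ τ m} = Set.Ici n := by ext m; simp [hτ.le_iff_le]
  simp [firstIndex, this]

lemma tendsto_firstIndex (hτ : Tendsto τ atTop atTop) (hm : StrictMono τ) :
    Tendsto (firstIndex τ) atTop atTop := by
  refine tendsto_atTop.2 fun n => ?_
  filter_upwards [eventually_ge_atTop (τ n)] with T hT
  exact hm.le_iff_le.1 (hT.trans (le_apply_firstIndex hτ T))

/-- When the increments of `τ` tend to zero, `τ` overshoots the time `T` at the first index that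
reaches it by an amount that tends to zero. -/
lemma tendsto_apply_firstIndex_sub (hτ : Tendsto τ atTop atTop) (hm : StrictMono τ)
    (hinc : Tendsto (fun n => τ (n + 1) - τ n) atTop (𝓝 0)) :
    Tendsto (fun T => τ (firstIndex τ T) - T) atTop (𝓝 0) := by
  have h1 : Tendsto (fun T => firstIndex τ T - 1) atTop atTop :=
    (tendsto_sub_atTop_nat 1).comp (tendsto_firstIndex hτ hm)
  refine squeeze_zero' (Eventually.of_forall fun T => sub_nonneg.2 (le_apply_firstIndex hτ T)) ?_
    (hinc.comp h1)
  filter_upwards [(tendsto_firstIndex hτ hm).eventually_ge_atTop 1] with T hT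
  have h2 : τ (firstIndex τ T - 1) < T := by
    by_contra! h
    have : firstIndex τ T ≤ firstIndex τ T - 1 := Nat.sInf_le h
    omega
  simp only [Function.comp]
  rw [Nat.sub_add_cancel hT]
  linarith

/-- Over a stretch of steps on which the directions stay within `ε` of `w`, the displacement is
`-w` times the elapsed time up to an error of `ε` times the elapsed time. -/
lemma norm_sub_add_smul_le {x v : ℕ → E} {a : ℕ → ℝ} (ha : ∀ n, 0 < a n)
    (hx : ∀ n, x (n + 1) = x n - a n • v n) (hτ : ∀ n, τ (n + 1) = τ n + a n) {w : E} {ε : ℝ}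
    {m n : ℕ} (hmn : m ≤ n) (hv : ∀ j, m ≤ j → j < n → ‖v j - w‖ ≤ ε) :
    ‖x n - x m + (τ n - τ m) • w‖ ≤ ε * (τ n - τ m) := by
  induction n, hmn using Nat.le_induction with
  | base => simp
  | succ n hmn ih =>
    have h1 := ih fun j h h' => hv j h (h'.trans n.lt_succ_self)
    have h2 := hv n hmn n.lt_succ_self
    have : x (n + 1) - x m + (τ (n + 1) - τ m) • w
        = (x n - x m + (τ n - τ m) • w) - a n • (v n - w) := by
      rw [hx, hτ]; module
    rw [this]
    calc _ ≤ ‖x n - x m + (τ n - τ m) • w‖ + ‖a n • (v n - w)‖ := norm_sub_le _ _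
      _ ≤ ε * (τ n - τ m) + a n * ε := by
        rw [norm_smul, Real.norm_of_nonneg (ha n).le]
        exact add_le_add h1 (mul_le_mul_of_nonneg_left h2 (ha n).le)
      _ = _ := by rw [hτ]; ring

/-- Through every cluster point `s` of a bounded sequence of approximate Euler steps
`x (n+1) = x n - a n • v n`, `v n - g (x n) → 0`, there passes a solution of `dX/dt = -g(X)` on
`[0, ∞)` that consists of cluster points of the sequence. It is a limit along an ultrafilter of
the sequence run at the time scale `τ n = ∑ j < n, a j` and restarted ever later; no uniqueness of
solutions is needed. -/
theorem exists_integralCurve_mapClusterPt [ProperSpace E] {x v : ℕ → E} {a : ℕ → ℝ} {g : E → E}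
    (hg : Continuous g) (ha : ∀ n, 0 < a n) (ha0 : Tendsto a atTop (𝓝 0))
    (hsum : Tendsto (fun n => ∑ k ∈ Finset.range n, a k) atTop atTop)
    (hx : ∀ n, x (n + 1) = x n - a n • v n) (hv : Tendsto (fun n => v n - g (x n)) atTop (𝓝 0))
    {R : ℝ} (hR : ∀ n, ‖x n‖ ≤ R) {s : E} (hs : MapClusterPt s atTop x) :
    ∃ X : ℝ → E, IsIntegralCurveOn X (fun _ z => -g z) (Set.Ici 0) ∧ X 0 = s ∧
      ∀ t, MapClusterPt (X t) atTop x := by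
  set τ : ℕ → ℝ := fun n => ∑ k ∈ Finset.range n, a k with hτdef
  have hτs : ∀ n, τ (n + 1) = τ n + a n := fun n => Finset.sum_range_succ _ _
  have hm : StrictMono τ := strictMono_nat_of_lt_succ fun n => by rw [hτs]; linarith [ha n]
  have hinc : Tendsto (fun n => τ (n + 1) - τ n) atTop (𝓝 0) := by simpa [hτs] using ha0
  obtain ⟨U, hU, hUs⟩ := mapClusterPt_iff_ultrafilter.1 hs
  -- `N k t` is the index reached after running for time `t` from the index `k`
  set N : ℕ → ℝ → ℕ := fun k t => firstIndex τ (τ k + t) with hN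
  have hT : ∀ t, Tendsto (fun k => τ k + t) U atTop := fun t =>
    (tendsto_atTop_add_const_right _ _ hsum).mono_left hU
  have hNt : ∀ t, Tendsto (fun k => N k t) U atTop := fun t =>
    (tendsto_firstIndex hsum hm).comp (hT t)
  have hover : ∀ t, Tendsto (fun k => τ (N k t) - (τ k + t)) U (𝓝 0) := fun t =>
    (tendsto_apply_firstIndex_sub hsum hm hinc).comp (hT t)
  have hlim : ∀ t, ∃ z, Tendsto (fun k => x (N k t)) U (𝓝 z) := by
    intro t
    obtain ⟨z, -, hz⟩ := (isCompact_closedBall (0 : E) R).ultrafilter_le_nhds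
      (U.map fun k => x (N k t)) (by
        refine le_principal_iff.2 (mem_map.2 (Filter.univ_mem' fun k => ?_))
        simpa using hR _)
    exact ⟨z, hz⟩
  choose X hX using hlim
  -- the directions are bounded by `C` from the index `n₀` on
  obtain ⟨C, hC0, n₀, hC⟩ : ∃ C > 0, ∃ n₀, ∀ n ≥ n₀, ‖v n‖ ≤ C := by
    obtain ⟨C, hC⟩ := (isCompact_closedBall (0 : E) R).exists_bound_of_continuousOn
      hg.continuousOn
    have h1 : ∀ᶠ n in atTop, ‖v n - g (x n)‖ < 1 := by
      simpa using hv.norm.eventually_lt_const (by simp : ‖(0 : E)‖ < 1)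
    obtain ⟨n₀, hn₀⟩ := eventually_atTop.1 h1
    have hC' : 0 ≤ C := (norm_nonneg _).trans (hC (x 0) (by simpa using hR 0))
    refine ⟨C + 1, by positivity, n₀, fun n hn => ?_⟩
    have h2 := hC (x n) (by simpa using hR n)
    have h3 := hn₀ n hn
    calc ‖v n‖ = ‖g (x n) + (v n - g (x n))‖ := by congr 1; abel
      _ ≤ C + 1 := (norm_add_le _ _).trans (by linarith)
  have hlip : ∀ m n, n₀ ≤ m → m ≤ n → ‖x n - x m‖ ≤ C * (τ n - τ m) := by
    intro m n hm0 hmn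
    simpa using norm_sub_add_smul_le (w := 0) (ε := C) ha hx hτs hmn
      (fun j hj _ => by simpa using hC j (hm0.trans hj))
  refine ⟨X, ?_, ?_, ?_⟩
  · intro t₀ ht₀
    -- near `t₀`, increments of `X` differ little from `-g (X t₀)` times the elapsed time
    have key : ∀ ε > 0, ∃ δ > 0, ∀ s t, t₀ - δ ≤ s → s ≤ t → t ≤ t₀ + δ →
        ‖X t - X s + (t - s) • g (X t₀)‖ ≤ ε * (t - s) := by
      intro ε hε
      obtain ⟨ρ, hρ, hgρ⟩ := Metric.continuousAt_iff.1 (hg.continuousAt (x := X t₀)) (ε / 2)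
        (by positivity)
      set δ := ρ / (8 * C) with hδ
      have hδ0 : 0 < δ := by positivity
      refine ⟨δ, hδ0, fun s t hs hst ht => ?_⟩
      have hNdiff : Tendsto (fun k => τ (N k t) - τ (N k s)) U (𝓝 (t - s)) := by
        have := ((hover t).sub (hover s)).add_const (t - s)
        simp only [sub_zero, zero_add] at this
        refine this.congr fun k => by ring
      refine le_of_tendsto_of_tendsto
        ((((hX t).sub (hX s)).add (hNdiff.smul_const (g (X t₀)))).norm)
        (hNdiff.const_mul ε) ?_
      obtain ⟨n₁, hn₁⟩ := eventually_atTop.1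
        (Metric.tendsto_nhds.1 hv (ε / 2) (by positivity))
      filter_upwards [(hover t).eventually_lt_const hδ0, (hover s).eventually_lt_const hδ0,
        (hover t₀).eventually_lt_const hδ0, (hNt s).eventually_ge_atTop (max n₀ n₁),
        (hNt t₀).eventually_ge_atTop n₀,
        Metric.tendsto_nhds.1 (hX t₀) (ρ / 2) (by positivity)] with k h1 h2 h3 h4 h5 h6
      have hst' : N k s ≤ N k t := firstIndex_mono hsum (by linarith)
      refine norm_sub_add_smul_le ha hx hτs hst' fun j hj hj' => ?_
      have g1 : τ k + s ≤ τ (N k s) := le_apply_firstIndex hsum _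
      have g2 : τ k + t₀ ≤ τ (N k t₀) := le_apply_firstIndex hsum _
      have g3 : τ (N k s) ≤ τ j := hm.monotone hj
      have g4 : τ j ≤ τ (N k t) := hm.monotone hj'.le
      have hd : ‖x j - x (N k t₀)‖ ≤ C * (2 * δ) := by
        rcases le_total j (N k t₀) with h | h
        · rw [norm_sub_rev]
          refine (hlip _ _ ((le_max_left _ _).trans (h4.trans hj)) h).trans ?_
          gcongr; linarith
        · refine (hlip _ _ h5 h).trans ?_
          gcongr; linarith
      have hC2 : C * (2 * δ) = ρ / 4 := by rw [hδ]; field_simp; norm_num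
      have hdist : dist (x j) (X t₀) < ρ := by
        have := dist_triangle (x j) (x (N k t₀)) (X t₀)
        rw [dist_eq_norm (x j) (x (N k t₀))] at this
        linarith
      have e1 := hgρ hdist
      have e2 := hn₁ j ((le_max_right _ _).trans (h4.trans hj))
      rw [dist_eq_norm] at e1
      rw [dist_zero_right] at e2
      calc ‖v j - g (X t₀)‖ = ‖(v j - g (x j)) + (g (x j) - g (X t₀))‖ := by congr 1; abel
        _ ≤ ε := (norm_add_le _ _).trans (by linarith)
    rw [hasDerivWithinAt_iff_isLittleO, Asymptotics.isLittleO_iff]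
    intro ε hε
    obtain ⟨δ, hδ, hk⟩ := key ε hε
    refine eventually_nhdsWithin_of_eventually_nhds ?_
    filter_upwards [Metric.ball_mem_nhds t₀ hδ] with t ht
    rw [Metric.mem_ball, Real.dist_eq, abs_lt] at ht
    rcases le_total t₀ t with h | h
    · have := hk t₀ t (by linarith) h (by linarith)
      rw [Real.norm_of_nonneg (sub_nonneg.2 h)]
      convert this using 2; module
    · have := hk t t₀ (by linarith) h (by linarith)
      rw [Real.norm_of_nonpos (sub_nonpos.2 h), neg_sub, norm_sub_rev]
      rw [← norm_neg] at this
      rw [← norm_neg]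
      convert this using 2; module
  · refine tendsto_nhds_unique (hX 0) (Tendsto.congr (fun k => ?_) hUs)
    simp [hN, firstIndex_apply hm]
  · intro t
    exact (hX t).mapClusterPt.of_comp (hNt t)

end DescentLimit

/-! ### Descent near a strict minimizer -/

section Descent

variable {E : Type*} [NormedAddCommGroup E] [InnerProductSpace ℝ E] [CompleteSpace E]

lemma continuous_gradient {L : E → ℝ} (hL : ContDiff ℝ 1 L) : Continuous (gradient L) :=
  (InnerProductSpace.toDual ℝ E).symm.continuous.comp (hL.continuous_fderiv one_ne_zero)

/-- First-order expansion of a `C¹` function: on a ball on which the gradient stays within `η` of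
`w`, the increments of `L` are those of the linear form `⟪w, ·⟫` up to a factor `η`. -/
lemma abs_sub_sub_inner_le {L : E → ℝ} (hL : ContDiff ℝ 1 L) {z w : E} {η r : ℝ}
    (h : ∀ u ∈ Metric.ball z r, ‖gradient L u - w‖ ≤ η) {u v : E} (hu : u ∈ Metric.ball z r)
    (hv : v ∈ Metric.ball z r) : |L v - L u - inner ℝ w (v - u)| ≤ η * ‖v - u‖ := by
  have hd : Differentiable ℝ L := hL.differentiable one_ne_zero
  have := (convex_ball z r).norm_image_sub_le_of_norm_hasFDerivWithin_le' (f := L)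
    (f' := fun u => InnerProductSpace.toDual ℝ E (gradient L u))
    (φ := InnerProductSpace.toDual ℝ E w) (C := η)
    (fun u _ => (hd u).hasGradientAt.hasFDerivAt.hasFDerivWithinAt)
    (fun u hu => by rw [← map_sub, LinearIsometryEquiv.norm_map]; exact h u hu) hu hv
  simpa using this

/-- A continuous map is uniformly continuous at the points of a compact set. -/
lemma exists_dist_lt_of_isCompact {X Y : Type*} [PseudoMetricSpace X] [PseudoMetricSpace Y]
    {g : X → Y} (hg : Continuous g) {s : Set X} (hs : IsCompact s) {κ : ℝ} (hκ : 0 < κ) :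
    ∃ ρ > 0, ∀ u ∈ s, ∀ v, dist u v < ρ → dist (g u) (g v) < κ := by
  have := hs.uniformContinuousAt_of_continuousAt g (fun _ _ => hg.continuousAt)
    (Metric.dist_mem_uniformity hκ)
  obtain ⟨ρ, hρ, h⟩ := Metric.mem_uniformity_dist.1 this
  exact ⟨ρ, hρ, fun u hu v huv => h huv hu⟩

/-- A sequence of approximate gradient steps that has a strict minimizer `z` as a cluster
point converges to `z`, provided `z` is an isolated critical point: outside every neighbourhood of
`z`, and close to it, each late step lowers `L`, so that small sublevel sets near `z` trap the
sequence. -/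
theorem tendsto_of_mapClusterPt_of_isolated [ProperSpace E] {L : E → ℝ} (hL : ContDiff ℝ 1 L)
    {z : E} (hmin : ∀ u, u ≠ z → L z < L u) {r₀ : ℝ} (hr₀ : 0 < r₀)
    (hcrit : ∀ u, dist u z < r₀ → gradient L u = 0 → u = z)
    {x v : ℕ → E} {a : ℕ → ℝ} (ha : ∀ n, 0 < a n) (ha0 : Tendsto a atTop (𝓝 0))
    (hx : ∀ n, x (n + 1) = x n - a n • v n)
    (hv : Tendsto (fun n => v n - gradient L (x n)) atTop (𝓝 0))
    (hz : MapClusterPt z atTop x) : Tendsto x atTop (𝓝 z) := by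
  rw [Metric.tendsto_atTop]
  intro ε hε
  obtain ⟨r, hr, hrr₀, hrε⟩ : ∃ r > 0, r < r₀ ∧ r < ε :=
    ⟨min r₀ ε / 2, by positivity, by linarith [min_le_left r₀ ε, lt_min hr₀ hε],
      by linarith [min_le_right r₀ ε, lt_min hr₀ hε]⟩
  have hLc : Continuous L := hL.continuous
  have hgc := continuous_gradient hL
  have hB : IsCompact (Metric.closedBall z r) := isCompact_closedBall z r
  -- `m` is a lower bound of `L`, above `L z`, on the annulus between the radii `r / 2` and `r`
  obtain ⟨m, hm, hmA⟩ : ∃ m, L z < m ∧ ∀ u, dist u z ≤ r → r / 2 ≤ dist u z → m ≤ L u := by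
    set A := Metric.closedBall z r ∩ {u | r / 2 ≤ dist u z} with hAdef
    have hA : IsCompact A := hB.inter_right (isClosed_le continuous_const
      (continuous_id.dist continuous_const))
    rcases A.eq_empty_or_nonempty with he | hne
    · refine ⟨L z + 1, by linarith, fun u h1 h2 => ?_⟩
      have : u ∈ A := ⟨h1, h2⟩
      simp [he] at this
    · obtain ⟨u₀, hu₀, h⟩ := hA.exists_isMinOn hne hLc.continuousOn
      refine ⟨L u₀, hmin u₀ ?_, fun u h1 h2 => h ⟨h1, h2⟩⟩
      rintro rfl
      have : r / 2 ≤ dist u₀ u₀ := hu₀.2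
      rw [dist_self] at this
      linarith
  set m' := (L z + m) / 2 with hm'
  obtain ⟨η, hη, hηB⟩ : ∃ η > 0, ∀ u, dist u z ≤ r → m' ≤ L u → η ≤ ‖gradient L u‖ := by
    set B := Metric.closedBall z r ∩ {u | m' ≤ L u} with hBdef
    have hB' : IsCompact B := hB.inter_right (isClosed_le continuous_const hLc)
    rcases B.eq_empty_or_nonempty with he | hne
    · refine ⟨1, one_pos, fun u h1 h2 => ?_⟩
      have : u ∈ B := ⟨h1, h2⟩
      simp [he] at this
    · obtain ⟨u₀, hu₀, h⟩ := hB'.exists_isMinOn hne hgc.norm.continuousOn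
      refine ⟨‖gradient L u₀‖, norm_pos_iff.2 fun h0 => ?_, fun u h1 h2 => h ⟨h1, h2⟩⟩
      have h1 : m' ≤ L u₀ := hu₀.2
      rw [hcrit u₀ (lt_of_le_of_lt hu₀.1 hrr₀) h0] at h1
      linarith
  obtain ⟨C, hC⟩ := hB.exists_bound_of_continuousOn hgc.continuousOn
  have hC0 : 0 ≤ C := (norm_nonneg _).trans (hC z (Metric.mem_closedBall_self hr.le))
  -- with errors of size at most `κ`, a step raises `L` by at most `a n * (η ^ 2 - ‖∇L‖ ^ 2)`
  obtain ⟨κ, hκ, hκ1, hκη⟩ : ∃ κ > 0, κ ≤ 1 ∧ κ * (2 * C + 1) ≤ η ^ 2 := by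
    refine ⟨min 1 (η ^ 2 / (2 * C + 1)), by positivity, min_le_left _ _, ?_⟩
    exact (mul_le_mul_of_nonneg_right (min_le_right _ _) (by positivity)).trans_eq
      (div_mul_cancel₀ _ (by positivity))
  obtain ⟨ρ, hρ, hρg⟩ := exists_dist_lt_of_isCompact hgc hB hκ
  have hstep : ∀ᶠ n in atTop, a n * (C + 1) < ρ ∧ a n * (C + 1) < r / 2 ∧
      a n * η ^ 2 < m - m' ∧ ‖v n - gradient L (x n)‖ < κ := by
    have h1 : ∀ b c : ℝ, 0 < c → ∀ᶠ n in atTop, a n * b < c := fun b c hc => by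
      have := ha0.mul_const b
      rw [zero_mul] at this
      exact this.eventually_lt_const hc
    filter_upwards [h1 (C + 1) ρ hρ, h1 (C + 1) (r / 2) (by positivity),
      h1 (η ^ 2) (m - m') (by linarith), Metric.tendsto_nhds.1 hv κ hκ] with n h1 h2 h3 h4
    exact ⟨h1, h2, h3, by simpa using h4⟩
  obtain ⟨n₀, hn₀⟩ := eventually_atTop.1 hstep
  have hinv : ∀ n ≥ n₀, dist (x n) z < r / 2 ∧ L (x n) < m →
      dist (x (n + 1)) z < r / 2 ∧ L (x (n + 1)) < m := by
    rintro n hn ⟨hd, hLn⟩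
    obtain ⟨h1, h2, h3, h4⟩ := hn₀ n hn
    have hxB : x n ∈ Metric.closedBall z r := by
      rw [Metric.mem_closedBall]; linarith
    have hgn := hC _ hxB
    have hvn : ‖v n‖ ≤ C + 1 := by
      calc ‖v n‖ = ‖gradient L (x n) + (v n - gradient L (x n))‖ := by congr 1; abel
        _ ≤ C + 1 := (norm_add_le _ _).trans (by linarith)
    have hD : x (n + 1) - x n = -(a n • v n) := by rw [hx]; abel
    have hDn : ‖x (n + 1) - x n‖ = a n * ‖v n‖ := by
      rw [hD, norm_neg, norm_smul, Real.norm_of_nonneg (ha n).le]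
    have hDn' : dist (x (n + 1)) (x n) ≤ a n * (C + 1) := by
      rw [dist_eq_norm, hDn]; exact mul_le_mul_of_nonneg_left hvn (ha n).le
    have hL1 : L (x (n + 1)) ≤ L (x n) + a n * (η ^ 2 - ‖gradient L (x n)‖ ^ 2) := by
      have e1 := abs_sub_sub_inner_le hL (z := x n) (w := gradient L (x n)) (η := κ) (r := ρ)
        (fun u hu => by
          rw [norm_sub_rev, ← dist_eq_norm]
          exact (hρg _ hxB u (by rw [dist_comm]; exact hu)).le)
        (Metric.mem_ball_self hρ) (v := x (n + 1)) (lt_of_le_of_lt hDn' h1)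
      have e2 := (abs_le.1 e1).2
      rw [hDn, hD, inner_neg_right, inner_smul_right] at e2
      have e3 : ‖gradient L (x n)‖ ^ 2 - C * κ ≤ inner ℝ (gradient L (x n)) (v n) := by
        have f1 : inner ℝ (gradient L (x n)) (v n)
            = ‖gradient L (x n)‖ ^ 2
              + inner ℝ (gradient L (x n)) (v n - gradient L (x n)) := by
          rw [inner_sub_right, real_inner_self_eq_norm_sq]; ring
        have f2 := (abs_le.1 (abs_real_inner_le_norm (gradient L (x n))
          (v n - gradient L (x n)))).1
        have f3 : ‖gradient L (x n)‖ * ‖v n - gradient L (x n)‖ ≤ C * κ :=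
          mul_le_mul hgn h4.le (norm_nonneg _) hC0
        linarith
      have e4 : κ * (a n * ‖v n‖) ≤ a n * (κ * (C + 1)) := by
        have := mul_le_mul_of_nonneg_left hvn (mul_pos hκ (ha n)).le
        linarith
      have e5 := mul_le_mul_of_nonneg_left e3 (ha n).le
      have e6 := mul_le_mul_of_nonneg_left hκη (ha n).le
      linarith
    have hL2 : L (x (n + 1)) < m := by
      rcases lt_or_ge (L (x n)) m' with h | h
      · have := mul_nonneg (ha n).le (sq_nonneg ‖gradient L (x n)‖)
        linarith
      · have e1 := hηB _ hxB h
        have e2 : η ^ 2 ≤ ‖gradient L (x n)‖ ^ 2 := pow_le_pow_left₀ hη.le e1 2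
        have := mul_nonneg (ha n).le (sub_nonneg.2 e2)
        linarith
    refine ⟨?_, hL2⟩
    by_contra! h
    have := hmA (x (n + 1)) (by linarith [dist_triangle (x (n + 1)) (x n) z]) h
    linarith
  have hU : {u | dist u z < r / 2 ∧ L u < m} ∈ 𝓝 z :=
    inter_mem (Metric.ball_mem_nhds z (by positivity : 0 < r / 2))
      (hLc.continuousAt.eventually_lt_const hm)
  obtain ⟨n₁, hn₁, hx₁⟩ := frequently_atTop.1 (hz.frequently hU) n₀
  refine ⟨n₁, fun n hn => ?_⟩
  have : dist (x n) z < r / 2 ∧ L (x n) < m := by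
    induction n, hn using Nat.le_induction with
    | base => exact hx₁
    | succ n hn ih => exact hinv n (hn₁.trans hn) ih
  linarith [this.1]

end Descent

/-! ### Conditional expectations and martingale convergence -/

section Martingale

variable {Ω : Type*} {m₀ : MeasurableSpace Ω} {μ : Measure Ω} [IsProbabilityMeasure μ]

/-- The conditional expectation given `X` of a function of `X` and of an independent `Y` is
obtained by integrating `Y` out. -/
lemma integral_ae_eq_condExp_of_indepFun {α β : Type*} [mα : MeasurableSpace α]
    [MeasurableSpace β] {X : Ω → α} {Y : Ω → β} {ν : Measure β} (hX : Measurable X)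
    (hY : HasLaw Y ν μ) (h : IndepFun X Y μ) {f : α × β → ℝ} (hf : StronglyMeasurable f)
    (hfi : Integrable (fun ω => f (X ω, Y ω)) μ) :
    (fun ω => ∫ y, f (X ω, y) ∂ν) =ᵐ[μ] μ[fun ω => f (X ω, Y ω) | mα.comap X] := by
  have : IsProbabilityMeasure ν := hY.isProbabilityMeasure_iff.1 inferInstance
  have : IsProbabilityMeasure (μ.map X) := Measure.isProbabilityMeasure_map hX.aemeasurable
  have hmap : μ.map (fun ω => (X ω, Y ω)) = (μ.map X).prod ν := by
    rw [(indepFun_iff_map_prod_eq_prod_map_map hX.aemeasurable hY.aemeasurable).1 h, hY.map_eq]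
  have hXY : AEMeasurable (fun ω => (X ω, Y ω)) μ := hX.aemeasurable.prodMk hY.aemeasurable
  have hfp : Integrable f ((μ.map X).prod ν) := by
    rw [← hmap, integrable_map_measure hf.aestronglyMeasurable hXY]; exact hfi
  have hF : StronglyMeasurable fun x => ∫ y, f (x, y) ∂ν := hf.integral_prod_right'
  have hFi : Integrable (fun x => ∫ y, f (x, y) ∂ν) (μ.map X) := hfp.integral_prod_left
  refine ae_eq_condExp_of_forall_setIntegral_eq hX.comap_le hfi
    (fun s _ _ => (hFi.comp_measurable hX).integrableOn) ?_
    (hF.comp_measurable (comap_measurable X)).aestronglyMeasurable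
  rintro _ ⟨t, ht, rfl⟩ -
  have e1 : ∫ ω in X ⁻¹' t, (∫ y, f (X ω, y) ∂ν) ∂μ = ∫ x in t, (∫ y, f (x, y) ∂ν) ∂(μ.map X) :=
    (setIntegral_map ht hF.aestronglyMeasurable hX.aemeasurable).symm
  have e2 : ∫ ω in X ⁻¹' t, f (X ω, Y ω) ∂μ
      = ∫ z in t ×ˢ Set.univ, f z ∂(μ.map fun ω => (X ω, Y ω)) := by
    rw [setIntegral_map (ht.prod MeasurableSet.univ) hf.aestronglyMeasurable hXY]
    congr 2
    ext ω; simp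
  rw [e1, e2, hmap, setIntegral_prod _ hfp.integrableOn]
  simp

/-- Multiplying by a variable `e` that is independent of everything else multiplies the conditional
expectation by the mean of `e`. -/
lemma condExp_mul_ae_eq_of_indepFun {α β : Type*} [mα : MeasurableSpace α]
    [mβ : MeasurableSpace β] {X : Ω → α} {Y : Ω → β} {e : Ω → ℝ} {u : β → ℝ} (hX : Measurable X)
    (hY : Measurable Y) (he : Measurable e) (hu : Measurable u)
    (h : IndepFun e (fun ω => (X ω, Y ω)) μ) (hei : Integrable e μ)
    (huei : Integrable (fun ω => u (Y ω) * e ω) μ) :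
    μ[fun ω => u (Y ω) * e ω | mα.comap X]
      =ᵐ[μ] fun ω => (∫ ω, e ω ∂μ) * (μ[fun ω => u (Y ω) | mα.comap X]) ω := by
  set Z : Ω → α × β := fun ω => (X ω, Y ω) with hZ
  have hZm : Measurable Z := hX.prodMk hY
  have hle : mα.comap X ≤ MeasurableSpace.comap Z inferInstance := by
    rintro _ ⟨t, ht, rfl⟩
    exact ⟨Prod.fst ⁻¹' t, measurable_fst ht, rfl⟩
  have hind := condExp_indep_eq he.comap_le hZm.comap_le (comap_measurable e).stronglyMeasurable h
  have hpull : μ[fun ω => u (Y ω) * e ω | MeasurableSpace.comap Z inferInstance]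
      =ᵐ[μ] fun ω => (∫ ω, e ω ∂μ) * u (Y ω) := by
    have hus : StronglyMeasurable[MeasurableSpace.comap Z inferInstance] fun ω => u (Y ω) :=
      ((hu.comp measurable_snd).comp (comap_measurable Z)).stronglyMeasurable
    refine (condExp_mul_of_stronglyMeasurable_left hus huei hei).trans ?_
    filter_upwards [hind] with ω hω
    rw [Pi.mul_apply, hω, mul_comm]
  refine (condExp_condExp_of_le hle hZm.comap_le).symm.trans ((condExp_congr_ae hpull).trans ?_)
  exact condExp_smul (∫ ω, e ω ∂μ) (fun ω => u (Y ω)) _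

/-- The sums of an adapted sequence with summable second moments, each term centred at its
conditional mean given the past, converge almost surely: they form a martingale bounded in `L²`. -/
theorem ae_exists_tendsto_sum_sub_condExp {ℱ : Filtration ℕ m₀} {X : ℕ → Ω → ℝ}
    (hX : ∀ n, StronglyMeasurable[ℱ (n + 1)] (X n)) (hX2 : ∀ n, MemLp (X n) 2 μ)
    (hs : Summable fun n => ∫ ω, X n ω ^ 2 ∂μ) :
    ∀ᵐ ω ∂μ, ∃ z, Tendsto (fun n => ∑ k ∈ Finset.range n, (X k ω - (μ[X k | ℱ k]) ω))
      atTop (𝓝 z) := by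
  set D : ℕ → Ω → ℝ := fun n => X n - μ[X n | ℱ n] with hD
  set S : ℕ → Ω → ℝ := fun n => ∑ k ∈ Finset.range n, D k with hS
  have hD2 : ∀ n, MemLp (D n) 2 μ := fun n => (hX2 n).sub ((hX2 n).condExp one_le_two)
  have hDi : ∀ n, Integrable (D n) μ := fun n => (hD2 n).integrable one_le_two
  have hD0 : ∀ n, μ[D n | ℱ n] =ᵐ[μ] 0 := by
    intro n
    have hXi := (hX2 n).integrable one_le_two
    refine (condExp_sub hXi integrable_condExp _).trans ?_
    rw [condExp_of_stronglyMeasurable (ℱ.le n) stronglyMeasurable_condExp integrable_condExp,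
      sub_self]
  have hDm : ∀ n, StronglyMeasurable[ℱ (n + 1)] (D n) := fun n =>
    (hX n).sub (stronglyMeasurable_condExp.mono (ℱ.mono n.le_succ))
  have hSm : StronglyAdapted ℱ S := fun n =>
    Finset.stronglyMeasurable_sum _ fun k hk => (hDm k).mono (ℱ.mono (Finset.mem_range.1 hk))
  have hS2 : ∀ n, MemLp (S n) 2 μ := fun n => memLp_finsetSum' _ fun k _ => hD2 k
  have hSD : ∀ n, S (n + 1) = S n + D n := fun n => Finset.sum_range_succ _ _
  have hmart : Martingale S ℱ μ := by
    refine martingale_of_condExp_sub_eq_zero_nat hSm (fun n => (hS2 n).integrable one_le_two) ?_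
    intro n
    rw [hSD, add_sub_cancel_left]
    exact hD0 n
  have hDX : ∀ n, ∫ ω, D n ω ^ 2 ∂μ ≤ ∫ ω, X n ω ^ 2 ∂μ := by
    intro n
    have h1 := integral_mono_ae (integrable_condVar (X := X n) (m := ℱ n)) integrable_condExp
      (condVar_ae_le_condExp_sq (ℱ.le n) (hX2 n))
    rw [integral_condExp (ℱ.le n), condVar, integral_condExp (ℱ.le n)] at h1
    exact h1
  have hSsq : ∀ n, ∫ ω, S n ω ^ 2 ∂μ = ∑ k ∈ Finset.range n, ∫ ω, D k ω ^ 2 ∂μ := by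
    intro n
    induction n with
    | zero => simp [hS]
    | succ n ih =>
      have hSDi : Integrable (S n * D n) μ := (hS2 n).integrable_mul (hD2 n)
      have h0 : ∫ ω, (S n * D n) ω ∂μ = 0 := by
        rw [← integral_condExp (ℱ.le n)]
        refine integral_eq_zero_of_ae ?_
        filter_upwards [condExp_mul_of_stronglyMeasurable_left (hSm n) hSDi (hDi n), hD0 n]
          with ω h1 h2
        rw [h1, Pi.mul_apply, h2]; simp
      rw [Finset.sum_range_succ, ← ih, hSD]
      have : ∀ ω, (S n + D n) ω ^ 2 = S n ω ^ 2 + D n ω ^ 2 + 2 * (S n * D n) ω := fun ω => by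
        simp only [Pi.add_apply, Pi.mul_apply]; ring
      simp_rw [this]
      rw [integral_add (f := fun ω => S n ω ^ 2 + D n ω ^ 2)
        ((hS2 n).integrable_sq.add (hD2 n).integrable_sq) (hSDi.const_mul 2),
        integral_add (hS2 n).integrable_sq (hD2 n).integrable_sq, integral_const_mul, h0]
      ring
  set A := ∑' n, ∫ ω, X n ω ^ 2 ∂μ with hA
  have hSA : ∀ n, ∫ ω, S n ω ^ 2 ∂μ ≤ A := fun n => by
    rw [hSsq]
    exact (Finset.sum_le_sum fun k _ => hDX k).trans
      (hs.sum_le_tsum _ fun k _ => integral_nonneg fun ω => sq_nonneg _)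
  have hbdd : ∀ n, eLpNorm (S n) 1 μ ≤ (Real.toNNReal (1 + A) : NNReal) := by
    intro n
    have hi := (hS2 n).integrable one_le_two
    rw [eLpNorm_one_eq_lintegral_enorm, ← ofReal_integral_norm_eq_lintegral_enorm hi]
    refine ENNReal.ofReal_le_ofReal ?_
    calc ∫ ω, ‖S n ω‖ ∂μ ≤ ∫ ω, (1 + S n ω ^ 2) ∂μ := by
          refine integral_mono hi.norm ((integrable_const 1).add (hS2 n).integrable_sq) fun ω => ?_
          have := sq_nonneg (‖S n ω‖ - 1)
          have h2 := sq_abs (S n ω)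
          simp only [Real.norm_eq_abs] at *
          nlinarith [abs_nonneg (S n ω)]
      _ ≤ 1 + A := by
          rw [integral_add (integrable_const 1) (hS2 n).integrable_sq]
          simpa using hSA n
  filter_upwards [hmart.submartingale.exists_ae_tendsto_of_bdd hbdd] with ω ⟨z, hz⟩
  exact ⟨z, by simpa [hS, hD] using hz⟩

end Martingale

/-! ### The mean of the gradient estimate -/

section GradEst

variable {p : ℕ} {L : EuclideanSpace ℝ (Fin p) → ℝ}

lemma rdsaGradEst_apply (c : ℝ) (x y : EuclideanSpace ℝ (Fin p)) (e₁ e₂ : ℝ) (l : Fin p) :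
    rdsaGradEst L c x y e₁ e₂ l
      = (2 * c)⁻¹ * (y l * L (x + c • y) - y l * L (x - c • y) + (y l * e₁ - y l * e₂)) := by
  simp only [rdsaGradEst, PiLp.smul_apply, smul_eq_mul]
  ring

lemma ae_norm_eq_sphereUniform (p : ℕ) : ∀ᵐ y ∂sphereUniform p, ‖y‖ = √(p : ℝ) := by
  have hm : Measurable fun x : Metric.sphere (0 : EuclideanSpace ℝ (Fin p)) 1 =>
      √(p : ℝ) • (x : EuclideanSpace ℝ (Fin p)) :=
    (continuous_subtype_val.const_smul √(p : ℝ)).measurable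
  refine (ae_map_iff hm.aemeasurable
    (measurableSet_eq_fun measurable_norm measurable_const)).2 (Eventually.of_forall fun x => ?_)
  simp [norm_smul]

/-- The mean of the noise-free gradient estimate at `x` over a random direction that is uniform on
the sphere of radius `√p`. -/
noncomputable def meanGradEst (L : EuclideanSpace ℝ (Fin p) → ℝ) (c : ℝ)
    (x : EuclideanSpace ℝ (Fin p)) : EuclideanSpace ℝ (Fin p) :=
  ∫ y, rdsaGradEst L c x y 0 0 ∂sphereUniform p

lemma continuous_rdsaGradEst (hL : Continuous L) (c : ℝ) :
    Continuous fun q : EuclideanSpace ℝ (Fin p) × EuclideanSpace ℝ (Fin p) =>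
      rdsaGradEst L c q.1 q.2 0 0 := by
  unfold rdsaGradEst
  fun_prop

lemma continuous_rdsaGradEst_right (hL : Continuous L) (c : ℝ) (x : EuclideanSpace ℝ (Fin p)) :
    Continuous fun y => rdsaGradEst L c x y 0 0 :=
  (continuous_rdsaGradEst hL c).comp (by fun_prop : Continuous fun y => (x, y))

lemma integrable_sphereUniform [IsFiniteMeasure (sphereUniform p)] {F : Type*}
    [NormedAddCommGroup F] [NormedSpace ℝ F] [SecondCountableTopology F]
    {f : EuclideanSpace ℝ (Fin p) → F} (hf : Continuous f) : Integrable f (sphereUniform p) := by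
  obtain ⟨C, hC⟩ := (isCompact_closedBall (0 : EuclideanSpace ℝ (Fin p)) √(p : ℝ))
    |>.exists_bound_of_continuousOn hf.continuousOn
  refine Integrable.of_bound hf.aestronglyMeasurable C ?_
  filter_upwards [ae_norm_eq_sphereUniform p] with y hy
  exact hC y (by simp [hy])

lemma integral_sphereUniform_apply [IsFiniteMeasure (sphereUniform p)]
    {f : EuclideanSpace ℝ (Fin p) → EuclideanSpace ℝ (Fin p)} (hf : Continuous f) (l : Fin p) :
    (∫ y, f y ∂sphereUniform p) l = ∫ y, f y l ∂sphereUniform p :=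
  ((EuclideanSpace.proj l : EuclideanSpace ℝ (Fin p) →L[ℝ] ℝ).integral_comp_comm
    (integrable_sphereUniform hf)).symm

/-- A direction with covariance matrix `I` satisfies `E[⟪w, π⟫ π] = w`. -/
lemma integral_inner_smul_sphereUniform [IsFiniteMeasure (sphereUniform p)]
    (hcov : ∀ i j, ∫ y, y i * y j ∂sphereUniform p = (1 : Matrix (Fin p) (Fin p) ℝ) i j)
    (w : EuclideanSpace ℝ (Fin p)) : ∫ y, (inner ℝ w y : ℝ) • y ∂sphereUniform p = w := by
  ext l
  rw [integral_sphereUniform_apply (by fun_prop)]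
  have : ∀ y : EuclideanSpace ℝ (Fin p), ((inner ℝ w y : ℝ) • y) l = ∑ i, w i * (y i * y l) := by
    intro y
    simp only [PiLp.smul_apply, smul_eq_mul, PiLp.inner_apply, Finset.sum_mul]
    refine Finset.sum_congr rfl fun i _ => ?_
    simp; ring
  simp_rw [this]
  rw [integral_finsetSum _ fun i _ => (integrable_sphereUniform (by fun_prop)).const_mul _]
  simp_rw [integral_const_mul, hcov]
  simp [Matrix.one_apply]

/-- Along a bounded sequence of points the bias of the gradient estimate vanishes as `c → 0`. -/
theorem tendsto_meanGradEst_sub_gradient [IsProbabilityMeasure (sphereUniform p)]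
    (hL : ContDiff ℝ 1 L)
    (hcov : ∀ i j, ∫ y, y i * y j ∂sphereUniform p = (1 : Matrix (Fin p) (Fin p) ℝ) i j)
    {c : ℕ → ℝ} (hc : ∀ n, 0 < c n) (hc0 : Tendsto c atTop (𝓝 0))
    {x : ℕ → EuclideanSpace ℝ (Fin p)} {R : ℝ} (hR : ∀ n, ‖x n‖ ≤ R) :
    Tendsto (fun n => meanGradEst L (c n) (x n) - gradient L (x n)) atTop (𝓝 0) := by
  rw [Metric.tendsto_nhds]
  intro ε hε
  set κ := ε / (p + 1) with hκdef
  have hκ : 0 < κ := by positivity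
  obtain ⟨ρ, hρ, hρg⟩ := exists_dist_lt_of_isCompact (continuous_gradient hL)
    (isCompact_closedBall (0 : EuclideanSpace ℝ (Fin p)) R) hκ
  have h1 : Tendsto (fun n => c n * √(p : ℝ)) atTop (𝓝 0) := by
    simpa using hc0.mul_const √(p : ℝ)
  filter_upwards [h1.eventually_lt_const hρ] with n hn
  set w := gradient L (x n) with hw
  have hball : ∀ u ∈ Metric.ball (x n) ρ, ‖gradient L u - w‖ ≤ κ := fun u hu => by
    rw [norm_sub_rev, ← dist_eq_norm]
    exact (hρg (x n) (by simpa using hR n) u (by rw [dist_comm]; exact hu)).le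
  have hcont : Continuous fun y => rdsaGradEst L (c n) (x n) y 0 0 :=
    continuous_rdsaGradEst_right hL.continuous (c n) (x n)
  have hsub : meanGradEst L (c n) (x n) - w
      = ∫ y, (rdsaGradEst L (c n) (x n) y 0 0 - (inner ℝ w y : ℝ) • y) ∂sphereUniform p := by
    rw [integral_sub (integrable_sphereUniform hcont) (integrable_sphereUniform (by fun_prop)),
      integral_inner_smul_sphereUniform hcov]
    rfl
  rw [dist_zero_right, hsub]
  have hle : ‖∫ y, (rdsaGradEst L (c n) (x n) y 0 0 - (inner ℝ w y : ℝ) • y) ∂sphereUniform p‖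
      ≤ κ * p * (sphereUniform p).real Set.univ := by
    refine norm_integral_le_of_norm_le_const ?_
    filter_upwards [ae_norm_eq_sphereUniform p] with y hy
    have hcy : ‖c n • y‖ < ρ := by
      rw [norm_smul, Real.norm_of_nonneg (hc n).le, hy]; exact hn
    have e1 := abs_sub_sub_inner_le hL hball (u := x n - c n • y) (v := x n + c n • y)
      (by simpa [dist_eq_norm] using hcy) (by simpa [dist_eq_norm] using hcy)
    have e2 : x n + c n • y - (x n - c n • y) = (2 * c n) • y := by module
    have h2c : 0 < 2 * c n := by linarith [hc n]
    rw [e2, inner_smul_right, norm_smul, Real.norm_of_nonneg h2c.le, hy] at e1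
    have e3 : rdsaGradEst L (c n) (x n) y 0 0 - (inner ℝ w y : ℝ) • y
        = ((2 * c n)⁻¹ * (L (x n + c n • y) - L (x n - c n • y) - 2 * c n * inner ℝ w y)) • y := by
      rw [rdsaGradEst, ← sub_smul]
      congr 1
      have := (hc n).ne'
      field_simp
      ring
    rw [e3, norm_smul, norm_mul, Real.norm_of_nonneg (inv_nonneg.2 h2c.le), hy, Real.norm_eq_abs]
    calc (2 * c n)⁻¹ * |L (x n + c n • y) - L (x n - c n • y) - 2 * c n * inner ℝ w y| * √(p : ℝ)
        ≤ (2 * c n)⁻¹ * (κ * (2 * c n * √(p : ℝ))) * √(p : ℝ) := by gcongr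
      _ = κ * (√(p : ℝ) * √(p : ℝ)) * ((2 * c n)⁻¹ * (2 * c n)) := by ring
      _ = κ * p := by
        rw [Real.mul_self_sqrt (Nat.cast_nonneg p), inv_mul_cancel₀ h2c.ne', mul_one]
  refine hle.trans_lt ?_
  rw [probReal_univ, mul_one, hκdef, div_mul_eq_mul_div, div_lt_iff₀ (by positivity)]
  linarith

variable {Ω : Type*} [MeasurableSpace Ω] {μ : Measure Ω}

lemma memLp_two_and_integral_sq_rdsaGradEst_le (hL : Continuous L) {c : ℝ} (hc : 0 < c)
    {θ π : Ω → EuclideanSpace ℝ (Fin p)} {e₁ e₂ : Ω → ℝ} (hθ : Measurable θ) (hπ : Measurable π)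
    (he₁ : Measurable e₁) (he₂ : Measurable e₂) (hπn : ∀ᵐ ω ∂μ, ‖π ω‖ = √(p : ℝ))
    {α₀ α₁ : ℝ} {l : Fin p}
    (h₁ : Integrable (fun ω => |e₁ ω| ^ 2) μ ∧ ∫ ω, |e₁ ω| ^ 2 ∂μ ≤ α₀)
    (h₂ : Integrable (fun ω => |e₂ ω| ^ 2) μ ∧ ∫ ω, |e₂ ω| ^ 2 ∂μ ≤ α₀)
    (h₃ : Integrable (fun ω => (π ω l) ^ 2 * L (θ ω + c • π ω) ^ 2) μ ∧
      ∫ ω, (π ω l) ^ 2 * L (θ ω + c • π ω) ^ 2 ∂μ ≤ α₁)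
    (h₄ : Integrable (fun ω => (π ω l) ^ 2 * L (θ ω - c • π ω) ^ 2) μ ∧
      ∫ ω, (π ω l) ^ 2 * L (θ ω - c • π ω) ^ 2 ∂μ ≤ α₁) :
    MemLp (fun ω => rdsaGradEst L c (θ ω) (π ω) (e₁ ω) (e₂ ω) l) 2 μ ∧
      ∫ ω, rdsaGradEst L c (θ ω) (π ω) (e₁ ω) (e₂ ω) l ^ 2 ∂μ
        ≤ (2 * α₁ + 2 * p * α₀) * (1 / c) ^ 2 := by
  have hm : Measurable fun ω => rdsaGradEst L c (θ ω) (π ω) (e₁ ω) (e₂ ω) l := by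
    simp only [rdsaGradEst_apply]
    have := hL.measurable
    fun_prop
  set B : Ω → ℝ := fun ω => ((π ω l) ^ 2 * L (θ ω + c • π ω) ^ 2
    + (π ω l) ^ 2 * L (θ ω - c • π ω) ^ 2 + (p * |e₁ ω| ^ 2 + p * |e₂ ω| ^ 2)) * (1 / c) ^ 2 with hB
  have hI₁ := h₃.1.add h₄.1
  have hI₂ := (h₁.1.const_mul (p : ℝ)).add (h₂.1.const_mul (p : ℝ))
  have hBi : Integrable B μ := (hI₁.add hI₂).mul_const _
  have hle : ∀ᵐ ω ∂μ, rdsaGradEst L c (θ ω) (π ω) (e₁ ω) (e₂ ω) l ^ 2 ≤ B ω := by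
    filter_upwards [hπn] with ω hω
    have hl : (π ω l) ^ 2 ≤ p := by
      have h5 : |π ω l| ≤ √(p : ℝ) := hω ▸ PiLp.norm_apply_le (π ω) l
      calc (π ω l) ^ 2 = |π ω l| ^ 2 := (sq_abs _).symm
        _ ≤ √(p : ℝ) ^ 2 := pow_le_pow_left₀ (abs_nonneg _) h5 2
        _ = p := Real.sq_sqrt (Nat.cast_nonneg p)
    have q : ∀ A B C D : ℝ, (A - B + (C - D)) ^ 2 ≤ 4 * (A ^ 2 + B ^ 2 + (C ^ 2 + D ^ 2)) :=
      fun A B C D => by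
        nlinarith [sq_nonneg (A + B), sq_nonneg (A - C), sq_nonneg (A + D), sq_nonneg (B + C),
          sq_nonneg (B - D), sq_nonneg (C + D)]
    rw [rdsaGradEst_apply, mul_pow, hB]
    have e1 : ((2 * c)⁻¹) ^ 2 = (1 / c) ^ 2 / 4 := by field_simp; norm_num
    have e2 := q (π ω l * L (θ ω + c • π ω)) (π ω l * L (θ ω - c • π ω)) (π ω l * e₁ ω)
      (π ω l * e₂ ω)
    have e3 : (π ω l * e₁ ω) ^ 2 ≤ p * |e₁ ω| ^ 2 := by
      rw [mul_pow, sq_abs]; exact mul_le_mul_of_nonneg_right hl (sq_nonneg _)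
    have e4 : (π ω l * e₂ ω) ^ 2 ≤ p * |e₂ ω| ^ 2 := by
      rw [mul_pow, sq_abs]; exact mul_le_mul_of_nonneg_right hl (sq_nonneg _)
    rw [e1]
    rw [mul_pow (π ω l) (L _), mul_pow (π ω l) (L _)] at e2
    have := mul_le_mul_of_nonneg_right (e2.trans (by linarith :
      _ ≤ 4 * ((π ω l) ^ 2 * L (θ ω + c • π ω) ^ 2 + (π ω l) ^ 2 * L (θ ω - c • π ω) ^ 2
        + (p * |e₁ ω| ^ 2 + p * |e₂ ω| ^ 2)))) (sq_nonneg (1 / c))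
    linarith
  have hsq : Integrable (fun ω => rdsaGradEst L c (θ ω) (π ω) (e₁ ω) (e₂ ω) l ^ 2) μ := by
    refine hBi.mono' (hm.pow_const 2).aestronglyMeasurable ?_
    filter_upwards [hle] with ω hω
    rwa [Real.norm_of_nonneg (sq_nonneg _)]
  refine ⟨(memLp_two_iff_integrable_sq hm.aestronglyMeasurable).2 hsq,
    (integral_mono_ae hsq hBi hle).trans ?_⟩
  rw [hB, integral_mul_const]
  refine mul_le_mul_of_nonneg_right ?_ (sq_nonneg _)
  rw [integral_add (f := fun ω => (π ω l) ^ 2 * L (θ ω + c • π ω) ^ 2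
      + (π ω l) ^ 2 * L (θ ω - c • π ω) ^ 2) (g := fun ω => p * |e₁ ω| ^ 2 + p * |e₂ ω| ^ 2)
      hI₁ hI₂, integral_add h₃.1 h₄.1,
    integral_add (h₁.1.const_mul (p : ℝ)) (h₂.1.const_mul (p : ℝ)), integral_const_mul,
    integral_const_mul]
  have e1 := mul_le_mul_of_nonneg_left h₁.2 (Nat.cast_nonneg (α := ℝ) p)
  have e2 := mul_le_mul_of_nonneg_left h₂.2 (Nat.cast_nonneg (α := ℝ) p)
  linarith [h₃.2, h₄.2]

/-- Given the history `X`, the mean of the gradient estimate is `meanGradEst` at the current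
iterate `T X`: the perturbation can be integrated out, and each noise term contributes its mean
times the same conditional expectation of the perturbation, so that the two cancel. -/
lemma condExp_rdsaGradEst [IsProbabilityMeasure μ] {α : Type*} [mα : MeasurableSpace α]
    (hL : Continuous L) {c : ℝ}
    {X : Ω → α} {T : α → EuclideanSpace ℝ (Fin p)} {π : Ω → EuclideanSpace ℝ (Fin p)}
    {e₁ e₂ : Ω → ℝ} (hX : Measurable X) (hT : Measurable T) (hπ : Measurable π)
    (he₁ : Measurable e₁) (he₂ : Measurable e₂) (hlaw : HasLaw π (sphereUniform p) μ)
    (hind : IndepFun π X μ) (hi₁ : IndepFun e₁ (fun ω => (X ω, π ω)) μ)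
    (hi₂ : IndepFun e₂ (fun ω => (X ω, π ω)) μ) (he₁i : Integrable e₁ μ) (he₂i : Integrable e₂ μ)
    (hmean : ∫ ω, (e₁ ω - e₂ ω) ∂μ = 0) (l : Fin p)
    (hint : Integrable (fun ω => rdsaGradEst L c (T (X ω)) (π ω) (e₁ ω) (e₂ ω) l) μ) :
    μ[fun ω => rdsaGradEst L c (T (X ω)) (π ω) (e₁ ω) (e₂ ω) l | mα.comap X]
      =ᵐ[μ] fun ω => meanGradEst L c (T (X ω)) l := by
  have : IsProbabilityMeasure (sphereUniform p) := hlaw.isProbabilityMeasure_iff.1 inferInstance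
  have hu : Measurable fun y : EuclideanSpace ℝ (Fin p) => y l := by fun_prop
  have hbd : ∀ᵐ ω ∂μ, ‖π ω l‖ ≤ √(p : ℝ) := by
    have h1 : ∀ᵐ y ∂(μ.map π), ‖y‖ = √(p : ℝ) := hlaw.map_eq ▸ ae_norm_eq_sphereUniform p
    filter_upwards [ae_of_ae_map hπ.aemeasurable h1] with ω hω
    exact hω ▸ PiLp.norm_apply_le (π ω) l
  have hπe : ∀ e : Ω → ℝ, Integrable e μ → Integrable (fun ω => π ω l * e ω) μ := fun e he =>
    he.bdd_mul (hu.comp hπ).aestronglyMeasurable hbd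
  set N : Ω → ℝ := fun ω => π ω l * e₁ ω - π ω l * e₂ ω with hN
  have hNi : Integrable N μ := (hπe e₁ he₁i).sub (hπe e₂ he₂i)
  have hN0 : μ[N | mα.comap X] =ᵐ[μ] 0 := by
    refine (condExp_sub (hπe e₁ he₁i) (hπe e₂ he₂i) _).trans ?_
    rw [integral_sub he₁i he₂i, sub_eq_zero] at hmean
    filter_upwards [condExp_mul_ae_eq_of_indepFun hX hπ he₁ hu hi₁ he₁i (hπe e₁ he₁i),
      condExp_mul_ae_eq_of_indepFun hX hπ he₂ hu hi₂ he₂i (hπe e₂ he₂i)] with ω h1 h2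
    rw [Pi.sub_apply, h1, h2, hmean, sub_self, Pi.zero_apply]
  set G : Ω → ℝ := fun ω => rdsaGradEst L c (T (X ω)) (π ω) 0 0 l with hG
  have hsplit : (fun ω => rdsaGradEst L c (T (X ω)) (π ω) (e₁ ω) (e₂ ω) l)
      = G + (2 * c)⁻¹ • N := by
    ext ω
    simp only [hG, hN, rdsaGradEst_apply, Pi.add_apply, Pi.smul_apply, smul_eq_mul]
    ring
  have hGi : Integrable G μ := by
    have : G = (fun ω => rdsaGradEst L c (T (X ω)) (π ω) (e₁ ω) (e₂ ω) l) - (2 * c)⁻¹ • N := by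
      rw [hsplit, add_sub_cancel_right]
    rw [this]
    exact hint.sub (hNi.smul _)
  have hmeas : StronglyMeasurable fun q : α × EuclideanSpace ℝ (Fin p) =>
      rdsaGradEst L c (T q.1) q.2 0 0 l :=
    (hu.comp ((continuous_rdsaGradEst hL c).measurable.comp
      ((hT.comp measurable_fst).prodMk measurable_snd))).stronglyMeasurable
  have hGc := integral_ae_eq_condExp_of_indepFun hX hlaw hind.symm hmeas hGi
  rw [hsplit]
  filter_upwards [condExp_add hGi (hNi.smul (2 * c)⁻¹) (mα.comap X), hGc,
    condExp_smul (2 * c)⁻¹ N (mα.comap X), hN0] with ω h1 h2 h3 h4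
  rw [h1, Pi.add_apply, h3, Pi.smul_apply, h4, ← h2, meanGradEst, integral_sphereUniform_apply
    (continuous_rdsaGradEst_right hL c (T (X ω)))]
  simp

end GradEst

/-! ### Convergence of the iterates -/

/-- Gradient steps with vanishing errors `w n - ∇L (θ n)` and convergent sums of the disturbances
`d n`: the shifted points `θ n - ∑ k ≥ n, d k` carry out gradient steps with vanishing errors only,
and share their cluster points with `θ`. A cluster point in the domain of attraction of `z` makes
`z` a cluster point. -/
theorem tendsto_of_perturbed_gradient_steps {p : ℕ} {L : EuclideanSpace ℝ (Fin p) → ℝ}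
    (hL : ContDiff ℝ 1 L) {z : EuclideanSpace ℝ (Fin p)} (hmin : ∀ u, u ≠ z → L z < L u)
    {r₀ : ℝ} (hr₀ : 0 < r₀) (hcrit : ∀ u, dist u z < r₀ → gradient L u = 0 → u = z)
    {a : ℕ → ℝ} (ha : ∀ n, 0 < a n) (ha0 : Tendsto a atTop (𝓝 0))
    (hsum : Tendsto (fun n => ∑ k ∈ Finset.range n, a k) atTop atTop)
    {θ w d : ℕ → EuclideanSpace ℝ (Fin p)} (hθ : ∀ n, θ (n + 1) = θ n - a n • w n - d n)
    (hw : Tendsto (fun n => w n - gradient L (θ n)) atTop (𝓝 0))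
    (hd : ∃ Z, Tendsto (fun n => ∑ k ∈ Finset.range n, d k) atTop (𝓝 Z))
    {R : ℝ} (hR : ∀ n, ‖θ n‖ ≤ R) {s : EuclideanSpace ℝ (Fin p)} (hs : MapClusterPt s atTop θ)
    (hsD : s ∈ domainOfAttraction L z) : Tendsto θ atTop (𝓝 z) := by
  obtain ⟨Z, hZ⟩ := hd
  set x : ℕ → EuclideanSpace ℝ (Fin p) := fun n => θ n + (∑ k ∈ Finset.range n, d k - Z) with hxdef
  have hg := continuous_gradient hL
  have hxθ : Tendsto (fun n => ∑ k ∈ Finset.range n, d k - Z) atTop (𝓝 0) := by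
    simpa using hZ.sub_const Z
  have hx : ∀ n, x (n + 1) = x n - a n • w n := fun n => by
    simp only [hxdef, hθ, Finset.sum_range_succ]; abel
  have hgx : Tendsto (fun n => gradient L (θ n) - gradient L (x n)) atTop (𝓝 0) := by
    rw [Metric.tendsto_nhds]
    intro ε hε
    obtain ⟨ρ, hρ, h⟩ := exists_dist_lt_of_isCompact hg
      (isCompact_closedBall (0 : EuclideanSpace ℝ (Fin p)) R) hε
    filter_upwards [Metric.tendsto_nhds.1 hxθ ρ hρ] with n hn
    rw [dist_zero_right] at hn ⊢
    rw [← dist_eq_norm]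
    refine h _ (by simpa using hR n) _ ?_
    rw [dist_comm]
    simpa [hxdef, dist_eq_norm] using hn
  have hv : Tendsto (fun n => w n - gradient L (x n)) atTop (𝓝 0) := by
    have := hw.add hgx
    rw [add_zero] at this
    exact this.congr fun n => by abel
  obtain ⟨R', hR'⟩ : ∃ R', ∀ n, ‖x n‖ ≤ R' := by
    obtain ⟨B, hB⟩ := hxθ.norm.bddAbove_range
    exact ⟨R + B, fun n => (norm_add_le _ _).trans (add_le_add (hR n) (hB ⟨n, rfl⟩))⟩
  have hsx : MapClusterPt s atTop x := by
    obtain ⟨U, hU, hUs⟩ := mapClusterPt_iff_ultrafilter.1 hs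
    refine mapClusterPt_iff_ultrafilter.2 ⟨U, hU, ?_⟩
    simpa using hUs.add (hxθ.mono_left hU)
  obtain ⟨X, hXcurve, hX0, hXcl⟩ :=
    exists_integralCurve_mapClusterPt hg ha ha0 hsum hx hv hR' hsx
  have hXz : Tendsto X atTop (𝓝 z) := hsD.2 X hXcurve hX0
  have hz : MapClusterPt z atTop x :=
    isClosed_setOfPred_clusterPt.mem_of_tendsto hXz (Eventually.of_forall hXcl)
  have hxz := tendsto_of_mapClusterPt_of_isolated hL hmin hr₀ hcrit ha ha0 hx hv hz
  have := hxz.sub hxθ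
  rw [sub_zero] at this
  exact this.congr fun n => by simp [hxdef]

lemma measurable_rdsa {Ω : Type*} [MeasurableSpace Ω] {p : ℕ} {L : EuclideanSpace ℝ (Fin p) → ℝ}
    (hL : Continuous L) (a c : ℕ → ℝ) {θ₀ : Ω → EuclideanSpace ℝ (Fin p)} (hθ₀ : Measurable θ₀)
    {π : ℕ → Ω → EuclideanSpace ℝ (Fin p)} (hπ : ∀ k, Measurable (π k)) {εp εm : ℕ → Ω → ℝ}
    (hεp : ∀ k, Measurable (εp k)) (hεm : ∀ k, Measurable (εm k)) (k : ℕ) :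
    Measurable (rdsa L a c π εp εm θ₀ k) := by
  induction k with
  | zero => exact hθ₀
  | succ k ih =>
    have := hL.measurable
    have := hπ k
    have := hεp k
    have := hεm k
    simp only [rdsa, rdsaGradEst]
    fun_prop

/-- An equilibrium near an asymptotically stable point is that point, because the constant curve
through it is attracted. -/
lemma IsAsymptoticallyStable.exists_isolated {p : ℕ} {L : EuclideanSpace ℝ (Fin p) → ℝ}
    {z : EuclideanSpace ℝ (Fin p)} (h : IsAsymptoticallyStable L z) :
    ∃ r > 0, ∀ u, dist u z < r → gradient L u = 0 → u = z := by
  obtain ⟨-, r, hr, hatt⟩ := h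
  refine ⟨r, hr, fun u hu h0 => ?_⟩
  refine tendsto_nhds_unique tendsto_const_nhds (hatt (fun _ => u) (fun t _ => ?_) hu)
  simpa [h0] using hasDerivWithinAt_const t (Set.Ici 0) u

lemma tendsto_euclideanSpace_iff {p : ℕ} {f : ℕ → EuclideanSpace ℝ (Fin p)}
    {z : EuclideanSpace ℝ (Fin p)} :
    Tendsto f atTop (𝓝 z) ↔ ∀ l, Tendsto (fun n => f n l) atTop (𝓝 (z l)) := by
  rw [(PiLp.homeomorph 2 fun _ : Fin p => ℝ).isInducing.tendsto_nhds_iff, tendsto_pi_nhds]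
  rfl

theorem mainTheorem3 {Ω : Type*} [MeasurableSpace Ω] (μ : Measure Ω) [IsProbabilityMeasure μ]
    (p : ℕ) (hp : 1 ≤ p)
    -- the loss function and its unique minimiser
    (L : EuclideanSpace ℝ (Fin p) → ℝ) (hL : ContDiff ℝ 1 L)
    (θstar : EuclideanSpace ℝ (Fin p)) (hmin : ∀ θ, θ ≠ θstar → L θstar < L θ)
    -- gains, initial vector, perturbations and measurement noises
    (a c : ℕ → ℝ) (θ₀ : Ω → EuclideanSpace ℝ (Fin p)) (hθ₀ : Measurable θ₀)
    (π : ℕ → Ω → EuclideanSpace ℝ (Fin p)) (hπ : ∀ k, Measurable (π k))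
    (εp εm : ℕ → Ω → ℝ) (hεp : ∀ k, Measurable (εp k)) (hεm : ∀ k, Measurable (εm k))
    -- the RDSA iterates
    (θ : ℕ → Ω → EuclideanSpace ℝ (Fin p)) (hθ : θ = rdsa L a c π εp εm θ₀)
    (K : ℕ)
    -- from `K` on: fresh perturbations, uniform on the sphere of radius `√p`
    (hπ_indep : ∀ k ≥ K, IndepFun (π k) (fun ω (j : Fin (k + 1)) => θ j ω) μ)
    (hπ_law : ∀ k ≥ K, HasLaw (π k) (sphereUniform p) μ)
    -- from `K` on: noise independent of the iterates so far and of the perturbation, with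
    -- differences of mean zero
    (hεp_indep : ∀ k ≥ K, IndepFun (εp k) (fun ω => (fun (j : Fin (k + 1)) => θ j ω, π k ω)) μ)
    (hεm_indep : ∀ k ≥ K, IndepFun (εm k) (fun ω => (fun (j : Fin (k + 1)) => θ j ω, π k ω)) μ)
    (hε_mean : ∀ k ≥ K, ∫ ω, (εp k ω - εm k ω) ∂μ = 0)
    -- A1
    (ha_pos : ∀ k, 0 < a k) (hc_pos : ∀ k, 0 < c k)
    (ha_lim : Tendsto a atTop (𝓝 0)) (hc_lim : Tendsto c atTop (𝓝 0))
    (ha_sum : Tendsto (fun n => ∑ k ∈ Finset.range n, a k) atTop atTop)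
    (hac_sum : Summable (fun k => (a k / c k) ^ 2))
    -- A2
    (hbdd : ∀ᵐ ω ∂μ, BddAbove (Set.range fun k => ‖θ k ω‖))
    -- A3
    (hstable : IsAsymptoticallyStable L θstar)
    -- A4
    (hrec : ∃ S : Set (EuclideanSpace ℝ (Fin p)), IsCompact S ∧ S ⊆ domainOfAttraction L θstar ∧
      ∀ᵐ ω ∂μ, ∃ᶠ k in atTop, θ k ω ∈ S)
    -- A5
    (hmom : MomentConditions μ L c θ π εp εm K) :
    ∀ᵐ ω ∂μ, Tendsto (fun k => θ k ω) atTop (𝓝 θstar) := by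
  have hLc : Continuous L := hL.continuous
  have hθm : ∀ k, Measurable (θ k) := fun k => by
    rw [hθ]; exact measurable_rdsa hLc a c hθ₀ hπ hεp hεm k
  have hθs : ∀ k ω, θ (k + 1) ω
      = θ k ω - a k • rdsaGradEst L (c k) (θ k ω) (π k ω) (εp k ω) (εm k ω) := fun k ω => by
    rw [hθ]; rfl
  obtain ⟨r₀, hr₀, hcrit⟩ := hstable.exists_isolated
  obtain ⟨S, hS, hSD, hSrec⟩ := hrec
  obtain ⟨α₀, hα₀, α₁, hα₁, hmom⟩ := hmom
  have hprob : IsProbabilityMeasure (sphereUniform p) :=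
    (hπ_law K le_rfl).isProbabilityMeasure_iff.1 inferInstance
  -- the moment condition on `π K` gives the covariance matrix of the uniform law
  have hcov : ∀ i j, ∫ y, y i * y j ∂sphereUniform p = (1 : Matrix (Fin p) (Fin p) ℝ) i j := by
    intro i j
    rw [← ((hmom K le_rfl).2.2.1 i j).2]
    exact ((hπ_law K le_rfl).integral_comp (f := fun y => y i * y j)
      (by fun_prop : Continuous fun y : EuclideanSpace ℝ (Fin p) =>
        y i * y j).aestronglyMeasurable).symm
  have hπn : ∀ k ≥ K, ∀ᵐ ω ∂μ, ‖π k ω‖ = √(p : ℝ) := fun k hk => by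
    have h1 : ∀ᵐ y ∂(μ.map (π k)), ‖y‖ = √(p : ℝ) :=
      (hπ_law k hk).map_eq ▸ ae_norm_eq_sphereUniform p
    exact ae_of_ae_map (hπ k).aemeasurable h1
  have hint : ∀ e : Ω → ℝ, Measurable e → Integrable (fun ω => |e ω| ^ 2) μ → Integrable e μ :=
    fun e he h => ((memLp_two_iff_integrable_sq he.aestronglyMeasurable).2
      (by simpa using h)).integrable one_le_two
  -- the iterates up to the time `k`
  let H : ∀ k, Ω → Fin (k + 1) → EuclideanSpace ℝ (Fin p) := fun k ω j => θ j ω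
  have hH : ∀ k, Measurable (H k) := fun k => measurable_pi_lambda _ fun j => hθm j
  -- at the index `n` the filtration knows the iterates up to `n + K`
  let ℱ : Filtration ℕ ‹MeasurableSpace Ω› :=
    { seq := fun n => MeasurableSpace.comap (H (n + K)) inferInstance
      mono' := by
        intro m n hmn
        have hle : m + K + 1 ≤ n + K + 1 := by omega
        have hr : Measurable fun (h : Fin (n + K + 1) → EuclideanSpace ℝ (Fin p))
            (j : Fin (m + K + 1)) => h (Fin.castLE hle j) :=
          measurable_pi_lambda _ fun j => measurable_pi_apply _
        exact Measurable.comap_le (hr.comp (comap_measurable (H (n + K))))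
      le' := fun n => (hH (n + K)).comap_le }
  set G : ℕ → Ω → EuclideanSpace ℝ (Fin p) := fun n ω =>
    rdsaGradEst L (c (n + K)) (θ (n + K) ω) (π (n + K) ω) (εp (n + K) ω) (εm (n + K) ω) with hG
  have hθG : ∀ n ω, θ (n + 1 + K) ω = θ (n + K) ω - a (n + K) • G n ω := fun n ω => by
    rw [show n + 1 + K = n + K + 1 by omega, hθs]
  have hGmom : ∀ n l, MemLp (fun ω => G n ω l) 2 μ ∧
      ∫ ω, G n ω l ^ 2 ∂μ ≤ (2 * α₁ + 2 * p * α₀) * (1 / c (n + K)) ^ 2 := by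
    intro n l
    have hk : n + K ≥ K := Nat.le_add_left K n
    obtain ⟨h1, h2, -, h3, h4⟩ := hmom _ hk
    exact memLp_two_and_integral_sq_rdsaGradEst_le hLc (hc_pos _) (hθm _) (hπ _) (hεp _) (hεm _)
      (hπn _ hk) h1 h2 (h3 l) (h4 l)
  have hGcond : ∀ n l, μ[fun ω => G n ω l | ℱ n]
      =ᵐ[μ] fun ω => meanGradEst L (c (n + K)) (θ (n + K) ω) l := by
    intro n l
    have hk : n + K ≥ K := Nat.le_add_left K n
    obtain ⟨h1, h2, -⟩ := hmom _ hk
    have hT : ∀ ω, H (n + K) ω (Fin.last (n + K)) = θ (n + K) ω := fun ω => rfl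
    have key := condExp_rdsaGradEst (μ := μ) (L := L) (c := c (n + K)) (X := H (n + K))
      (T := fun h => h (Fin.last (n + K))) (π := π (n + K)) (e₁ := εp (n + K)) (e₂ := εm (n + K))
      hLc (hH (n + K)) (measurable_pi_apply _) (hπ _) (hεp _) (hεm _) (hπ_law _ hk)
      (hπ_indep _ hk) (hεp_indep _ hk) (hεm_indep _ hk) (hint _ (hεp _) h1.1)
      (hint _ (hεm _) h2.1) (hε_mean _ hk) l
    simp only [hT] at key
    exact key ((hGmom n l).1.integrable one_le_two)
  -- the martingale part of the recursion converges
  have hmart : ∀ l, ∀ᵐ ω ∂μ, ∃ z, Tendsto (fun n => ∑ k ∈ Finset.range n,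
      (a (k + K) * G k ω l - a (k + K) * meanGradEst L (c (k + K)) (θ (k + K) ω) l))
      atTop (𝓝 z) := by
    intro l
    -- the estimate is known at the next time because it is proportional to `θ k - θ (k + 1)`
    have hXm : ∀ n, StronglyMeasurable[ℱ (n + 1)] fun ω => a (n + K) * G n ω l := by
      intro n
      have h1 : (fun ω => a (n + K) * G n ω l) = (fun h : Fin (n + 1 + K + 1) →
          EuclideanSpace ℝ (Fin p) => h ⟨n + K, by omega⟩ l - h ⟨n + 1 + K, by omega⟩ l)
          ∘ H (n + 1 + K) := by
        ext ω
        simp [H, hθG n ω]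
      rw [h1]
      refine Measurable.stronglyMeasurable (Measurable.comp ?_ (comap_measurable (H (n + 1 + K))))
      fun_prop
    have hX2 : ∀ n, MemLp (fun ω => a (n + K) * G n ω l) 2 μ := fun n =>
      (hGmom n l).1.const_mul _
    have hXs : Summable fun n => ∫ ω, (a (n + K) * G n ω l) ^ 2 ∂μ := by
      refine Summable.of_nonneg_of_le (fun n => integral_nonneg fun ω => sq_nonneg _) (fun n => ?_)
        (((summable_nat_add_iff K).2 hac_sum).mul_left (2 * α₁ + 2 * p * α₀))
      simp_rw [mul_pow]
      rw [integral_const_mul]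
      refine (mul_le_mul_of_nonneg_left (hGmom n l).2 (sq_nonneg _)).trans_eq ?_
      ring
    have hcond : ∀ᵐ ω ∂μ, ∀ n, (μ[fun ω => a (n + K) * G n ω l | ℱ n]) ω
        = a (n + K) * meanGradEst L (c (n + K)) (θ (n + K) ω) l := by
      refine ae_all_iff.2 fun n => ?_
      filter_upwards [condExp_smul (μ := μ) (a (n + K)) (fun ω => G n ω l) (ℱ n), hGcond n l]
        with ω h1 h2
      have h3 : (fun ω => a (n + K) * G n ω l) = a (n + K) • fun ω => G n ω l := rfl
      rw [h3, h1, Pi.smul_apply, h2, smul_eq_mul]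
    filter_upwards [ae_exists_tendsto_sum_sub_condExp hXm hX2 hXs, hcond] with ω ⟨z, hz⟩ h
    exact ⟨z, by simpa only [h] using hz⟩
  filter_upwards [ae_all_iff.2 hmart, hbdd, hSrec] with ω hω hb hrecω
  obtain ⟨R, hR⟩ := hb
  have hRn : ∀ n, ‖θ (n + K) ω‖ ≤ R := fun n => hR ⟨n + K, rfl⟩
  obtain ⟨s, hsS, hs⟩ := hS.exists_mapClusterPt_of_frequently hrecω
  have hs' : MapClusterPt s atTop fun n => θ (n + K) ω := by
    rw [MapClusterPt, show (fun n => θ (n + K) ω) = (fun k => θ k ω) ∘ (· + K) from rfl,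
      ← map_map, map_add_atTop_eq_nat]
    exact hs
  rw [← tendsto_add_atTop_iff_nat K]
  have hcK : Tendsto (fun n => c (n + K)) atTop (𝓝 0) := (tendsto_add_atTop_iff_nat K).2 hc_lim
  refine tendsto_of_perturbed_gradient_steps hL hmin hr₀ hcrit (a := fun n => a (n + K))
    (w := fun n => meanGradEst L (c (n + K)) (θ (n + K) ω))
    (d := fun n => a (n + K) • (G n ω - meanGradEst L (c (n + K)) (θ (n + K) ω)))
    (fun n => ha_pos _) ((tendsto_add_atTop_iff_nat K).2 ha_lim) ?_ (fun n => ?_)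
    (tendsto_meanGradEst_sub_gradient hL hcov (fun n => hc_pos _) hcK hRn) ?_ hRn hs' (hSD hsS)
  · have h1 := (tendsto_add_atTop_iff_nat K).2 ha_sum
    refine (tendsto_atTop_add_const_right _ (-∑ k ∈ Finset.range K, a k) h1).congr fun n => ?_
    rw [add_comm n K, Finset.sum_range_add]
    simp only [add_comm K]
    ring
  · rw [hθG, smul_sub]
    abel
  · choose Z hZ using hω
    refine ⟨WithLp.toLp 2 Z, tendsto_euclideanSpace_iff.2 fun l => (hZ l).congr fun n => ?_⟩
    simp [mul_sub]
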